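/- All omega graphs, omega magmas and categories below are small. An omega graph is a reflexive globular set $X$ with domains, codomains and identities. An omega magma is an omega graph with composites $a\bigcirc_i^j b$ ($i<j$) of all pairs of $j$-cells with $\mathrm{cod}_i^j a=\mathrm{dom}_i^j b$, compatible with domains and codomains; it is a strict omega category if the composites satisfy associativity, interchange, identity and identity interchange. A bridge relation $R$ on an omega graph $X$ is a family of relations $R_i\subseteq X_i\times X_i\times X_{i+1}$ such that $(a,b,c)\in R_i$ implies that $a,b$ are parallel and $c$ goes from $a$ to $b$, $(a,a,\mathrm{id}\,a)\in R_i$ for all $a$, and $c$ is determined by $a,b$; the diagonal one $R^\Delta$ consists of the triples $(a,a,\mathrm{id}\,a)$. A categorical Penon morphism $F:(X,R)\to(Y,R^\Delta)$ is a morphism of omega magmas that preserves bridges, where $Y$ is a strict omega category, $(a,b,c)\in R_i$ implies $Fa=Fb$ and $Fc=\mathrm{id}(Fa)$, and whenever $a,b\in X_i$ are parallel with $Fa=Fb$ there is $c$ with $(a,b,c)\in R_i$. Let Pen_Mor be the category of categorical Penon morphisms and commutative squares of bridge morphisms, and $U_G^P$ : Pen_Mor $\to$ Omega_Graph the functor that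 sends $F:(X,R)\to (Y,R^\Delta)$ to the omega graph underlying $X$. A weak omega category $\mathbf X$ consists of omega magmas $X_1,X_2$, a morphism of omega magmas $\lambda^X:X_2\to X_1$, a morphism of omega graphs $\rho^X:X_1\to X_2$ with $\lambda^X\rho^X=1$, a bridge relation $R^X$ on $X_2$, a strict omega category $X_3$, and a categorical Penon morphism $\kappa^X:(X_2,R^X)\to (X_3,R^\Delta)$. An omega functor is a triple $(F_1,F_2,F_3)$ of morphisms of omega magmas $F_i:X_i\to Y_i$ that commutes with $\lambda,\rho,\kappa$ and such that $F_2$ preserves bridges. These form the category Omega_Cat. **Theorem.** (1) $U_G^P$ has a left adjoint. (2) Let $L_P^G\dashv U_G^P$ be any left adjoint with its adjunction, write $\eta_P(Y):M_P(Y)\to C(Y)$ for $L_P^G Y$, and let $\mathbb T=U_G^P L_P^G$ be the induced monad on Omega_Graph. Let Prolixe be the category of $\mathbb T$-algebras. Let Pen_Omega_Cat be the full subcategory of Omega_Cat on those $\mathbf X$ such that, for $Y$ the omega graph underlying $X_1$, $\kappa^X=\eta_P(Y)$ (including the bridge relation) and $\rho^X:Y\to M_P(Y)$ is the unit of the adjunction.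 Let $S$ : Prolixe $\to$ Pen_Omega_Cat be the functor that sends an algebra $h:\mathbb TY\to Y$ with unit $\rho:Y\to\mathbb TY$ to the weak omega category with $X_1=Y$ (with composites $a\bigcirc_i^j b=h(\rho a\bigcirc_i^j\rho b)$), $X_2=M_P(Y)$, $\lambda=h$, $\rho$ the unit, $\kappa=\eta_P(Y)$, and an algebra morphism $f:Y\to Y'$ to $(f,L_P^G f)$. Then Prolixe is a retract of Pen_Omega_Cat: there is a functor $U$ : Pen_Omega_Cat $\to$ Prolixe with $$U\circ S=1_{\mathrm{Prolixe}}.$$ Moreover $U$ can be chosen so that $U(\mathbf X)$ is the algebra $\lambda^X:\mathbb TY\to Y$ for each $\mathbf X$ in Pen_Omega_Cat for which $\lambda^X:\mathbb TY\to Y$ satisfies the associativity law of a $\mathbb T$-algebra, and $U(F_1,F_2,F_3)=F_1$ on omega functors between such objects. -/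

import Mathlib

open CategoryTheory

universe u

namespace WeakOmega

/-! ### Globular sets, omega graphs, omega magmas, strict omega categories -/

/-- A globular set. -/
structure GlobularSet where
  cell : ℕ → Type u
  dom : ∀ {n : ℕ}, cell (n + 1) → cell n
  cod : ∀ {n : ℕ}, cell (n + 1) → cell n
  dom_dom : ∀ {n : ℕ} (x : cell (n + 2)), dom (dom x) = dom (cod x)
  cod_dom : ∀ {n : ℕ} (x : cell (n + 2)), cod (dom x) = cod (cod x)

namespace GlobularSet

/-- The iterated domain `X_j → X_i` for `i ≤ j`: the identity for `j = i`, and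
`domTo i j ∘ dom` on `X_{j+1}`. -/
def domTo (X : GlobularSet.{u}) {i j : ℕ} (h : i ≤ j) : X.cell j → X.cell i :=
  Nat.leRec (motive := fun j _ => X.cell j → X.cell i) (fun x => x)
    (fun _ _ f x => f (X.dom x)) h

/-- The iterated codomain `X_j → X_i` for `i ≤ j`. -/
def codTo (X : GlobularSet.{u}) {i j : ℕ} (h : i ≤ j) : X.cell j → X.cell i :=
  Nat.leRec (motive := fun j _ => X.cell j → X.cell i) (fun x => x)
    (fun _ _ f x => f (X.cod x)) h

theorem domTo_self (X : GlobularSet.{u}) {i : ℕ} (x : X.cell i) :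
    X.domTo (le_refl i) x = x := by
  simp [domTo, Nat.leRec_self]

theorem domTo_succ (X : GlobularSet.{u}) {i j : ℕ} (h : i ≤ j) (x : X.cell (j + 1)) :
    X.domTo (Nat.le_succ_of_le h) x = X.domTo h (X.dom x) := by
  rw [domTo, Nat.leRec_succ _ _ h]; rfl

theorem codTo_self (X : GlobularSet.{u}) {i : ℕ} (x : X.cell i) :
    X.codTo (le_refl i) x = x := by
  simp [codTo, Nat.leRec_self]

theorem codTo_succ (X : GlobularSet.{u}) {i j : ℕ} (h : i ≤ j) (x : X.cell (j + 1)) :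
    X.codTo (Nat.le_succ_of_le h) x = X.codTo h (X.cod x) := by
  rw [codTo, Nat.leRec_succ _ _ h]; rfl

/-- Two `n`-cells are parallel if they have the same domain and the same codomain; any two
`0`-cells are parallel. -/
def Parallel (X : GlobularSet.{u}) : ∀ {n : ℕ}, X.cell n → X.cell n → Prop
  | 0, _, _ => True
  | _ + 1, a, b => X.dom a = X.dom b ∧ X.cod a = X.cod b

end GlobularSet

/-- An omega graph, i.e. a reflexive globular set. -/
structure OmegaGraph extends GlobularSet.{u} where
  ident : ∀ {n : ℕ}, cell n → cell (n + 1)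
  dom_ident : ∀ {n : ℕ} (x : cell n), dom (ident x) = x
  cod_ident : ∀ {n : ℕ} (x : cell n), cod (ident x) = x

/-- The iterated identity `X_i → X_j` for `i ≤ j`. -/
def OmegaGraph.identTo (X : OmegaGraph.{u}) {i j : ℕ} (h : i ≤ j) : X.cell i → X.cell j :=
  fun x => Nat.leRec (motive := fun j _ => X.cell j) x (fun _ _ y => X.ident y) h

/-- Morphisms of omega graphs. -/
@[ext]
structure OmegaGraph.Hom (X Y : OmegaGraph.{u}) where
  app : ∀ {n : ℕ}, X.cell n → Y.cell n
  map_dom : ∀ {n : ℕ} (x : X.cell (n + 1)), app (X.dom x) = Y.dom (app x)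
  map_cod : ∀ {n : ℕ} (x : X.cell (n + 1)), app (X.cod x) = Y.cod (app x)
  map_ident : ∀ {n : ℕ} (x : X.cell n), app (X.ident x) = Y.ident (app x)

instance : Category.{u} OmegaGraph.{u} where
  Hom := OmegaGraph.Hom
  id X :=
    { app := fun x => x
      map_dom := fun _ => rfl
      map_cod := fun _ => rfl
      map_ident := fun _ => rfl }
  comp f g :=
    { app := fun x => g.app (f.app x)
      map_dom := fun x => by rw [f.map_dom, g.map_dom]
      map_cod := fun x => by rw [f.map_cod, g.map_cod]
      map_ident := fun x => by rw [f.map_ident, g.map_ident] }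

/-- An omega magma: an omega graph with composition relations
`Comp_i^j ⊆ X_j × X_j × X_j` for `i < j`. -/
structure OmegaMagma extends OmegaGraph.{u} where
  Comp : ∀ {i j : ℕ}, i < j → cell j → cell j → cell j → Prop
  comp_composable : ∀ {i j : ℕ} (h : i < j) {a b c : cell j}, Comp h a b c →
    toGlobularSet.codTo h.le a = toGlobularSet.domTo h.le b
  comp_unique : ∀ {i j : ℕ} (h : i < j) {a b c d : cell j}, Comp h a b c → Comp h a b d → c = d
  comp_exists : ∀ {i j : ℕ} (h : i < j) {a b : cell j},
    toGlobularSet.codTo h.le a = toGlobularSet.domTo h.le b → ∃ c, Comp h a b c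
  comp_top : ∀ {i : ℕ} {a b c : cell (i + 1)}, Comp (Nat.lt_succ_self i) a b c →
    dom c = dom a ∧ cod c = cod b
  comp_boundary : ∀ {i j : ℕ} (h : i < j) {a b c : cell (j + 1)},
    Comp (Nat.lt_succ_of_lt h) a b c →
      Comp h (dom a) (dom b) (dom c) ∧ Comp h (cod a) (cod b) (cod c)

/-- Morphisms of omega magmas: morphisms of omega graphs that preserve composition. -/
@[ext]
structure OmegaMagma.Hom (X Y : OmegaMagma.{u}) extends
    OmegaGraph.Hom X.toOmegaGraph Y.toOmegaGraph where
  map_comp : ∀ {i j : ℕ} (h : i < j) {a b c : X.cell j}, X.Comp h a b c →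
    Y.Comp h (app a) (app b) (app c)

instance : Category.{u} OmegaMagma.{u} where
  Hom := OmegaMagma.Hom
  id X := { toHom := 𝟙 X.toOmegaGraph, map_comp := fun _ _ _ _ h => h }
  comp {X Y Z} f g :=
    { toHom := CategoryStruct.comp (X := X.toOmegaGraph) (Y := Y.toOmegaGraph)
        (Z := Z.toOmegaGraph) f.toHom g.toHom
      map_comp := fun h _ _ _ H => g.map_comp h (f.map_comp h H) }

/-- The forgetful functor from omega magmas to omega graphs. -/
abbrev OmegaMagma.forget : OmegaMagma.{u} ⥤ OmegaGraph.{u} where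
  obj X := X.toOmegaGraph
  map f := f.toHom

/-- The axioms of a strict omega category. A law between composites is imposed whenever all
the composites that occur in it are defined. -/
structure OmegaMagma.IsStrict (X : OmegaMagma.{u}) : Prop where
  /-- `(a ∘ b) ∘ c = a ∘ (b ∘ c)` -/
  assoc : ∀ {i j : ℕ} (h : i < j) {a b c ab bc l r : X.cell j},
    X.Comp h a b ab → X.Comp h ab c l → X.Comp h b c bc → X.Comp h a bc r → l = r
  /-- `(a ∘_j b) ∘_i (c ∘_j d) = (a ∘_i c) ∘_j (b ∘_i d)` for `i < j < k` -/
  interchange : ∀ {i j k : ℕ} (hij : i < j) (hjk : j < k)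
    {a b c d ab cd ac bd l r : X.cell k},
    X.Comp hjk a b ab → X.Comp hjk c d cd → X.Comp (hij.trans hjk) ab cd l →
    X.Comp (hij.trans hjk) a c ac → X.Comp (hij.trans hjk) b d bd → X.Comp hjk ac bd r →
    l = r
  ident_comp : ∀ {i j : ℕ} (h : i < j) (a : X.cell j),
    X.Comp h (X.identTo h.le (X.domTo h.le a)) a a
  comp_ident : ∀ {i j : ℕ} (h : i < j) (a : X.cell j),
    X.Comp h a (X.identTo h.le (X.codTo h.le a)) a
  /-- `id a ∘_i id b = id (a ∘_i b)` -/
  ident_interchange : ∀ {i j : ℕ} (h : i < j) {a b c : X.cell j},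
    X.Comp h a b c → X.Comp (Nat.lt_succ_of_lt h) (X.ident a) (X.ident b) (X.ident c)

/-! ### Bridge relations and categorical Penon morphisms -/

/-- A bridge relation on an omega graph. -/
structure BridgeRelation (X : OmegaGraph.{u}) where
  Rel : ∀ {n : ℕ}, X.cell n → X.cell n → X.cell (n + 1) → Prop
  boundary : ∀ {n : ℕ} {a b : X.cell n} {c : X.cell (n + 1)}, Rel a b c →
    X.Parallel a b ∧ X.dom c = a ∧ X.cod c = b
  refl : ∀ {n : ℕ} (a : X.cell n), Rel a a (X.ident a)
  unique : ∀ {n : ℕ} {a b : X.cell n} {c d : X.cell (n + 1)}, Rel a b c → Rel a b d → c = d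

theorem GlobularSet.Parallel.refl (X : GlobularSet.{u}) {n : ℕ} (a : X.cell n) :
    X.Parallel a a := by
  cases n with
  | zero => trivial
  | succ n => exact ⟨rfl, rfl⟩

/-- The diagonal bridge relation, whose elements are the triples `(a, a, id a)`. -/
def BridgeRelation.diagonal (X : OmegaGraph.{u}) : BridgeRelation X where
  Rel a b c := a = b ∧ c = X.ident a
  boundary := by
    rintro n a b c ⟨rfl, rfl⟩
    exact ⟨GlobularSet.Parallel.refl _ _, X.dom_ident _, X.cod_ident _⟩
  refl _ := ⟨rfl, rfl⟩
  unique := by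
    rintro n a b c d ⟨_, rfl⟩ ⟨_, rfl⟩
    rfl

/-- A morphism of omega magmas is a bridge morphism if it carries bridges to bridges. -/
def IsBridgeMorphism {X Y : OmegaMagma.{u}} (R : BridgeRelation X.toOmegaGraph)
    (S : BridgeRelation Y.toOmegaGraph) (F : X ⟶ Y) : Prop :=
  ∀ {n : ℕ} {a b : X.cell n} {c : X.cell (n + 1)}, R.Rel a b c →
    S.Rel (F.app a) (F.app b) (F.app c)

/-- `F : (X, R) → (Y, R^Δ)` is a categorical Penon morphism. -/
structure IsCategoricalPenon {X Y : OmegaMagma.{u}} (R : BridgeRelation X.toOmegaGraph)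
    (F : X ⟶ Y) : Prop where
  isBridge : IsBridgeMorphism R (BridgeRelation.diagonal Y.toOmegaGraph) F
  strict : Y.IsStrict
  collapse : ∀ {n : ℕ} {a b : X.cell n} {c : X.cell (n + 1)}, R.Rel a b c →
    F.app a = F.app b ∧ F.app c = Y.ident (F.app a) ∧ F.app c = Y.ident (F.app b)
  bridge_exists : ∀ {n : ℕ} {a b : X.cell n}, X.Parallel a b → F.app a = F.app b →
    ∃ c, R.Rel a b c

/-- Objects of `Pen_Mor`: categorical Penon morphisms. -/
structure PenMor where
  source : OmegaMagma.{u}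
  bridge : BridgeRelation source.toOmegaGraph
  target : OmegaMagma.{u}
  map : source ⟶ target
  isPenon : IsCategoricalPenon bridge map

/-- Morphisms of `Pen_Mor`: commutative squares of bridge morphisms. (Every omega magma morphism
is a bridge morphism for the diagonal bridge relations, so nothing more is asked of `right`.) -/
@[ext]
structure PenMor.Hom (P Q : PenMor.{u}) where
  left : P.source ⟶ Q.source
  right : P.target ⟶ Q.target
  isBridge : IsBridgeMorphism P.bridge Q.bridge left
  comm : P.map ≫ right = left ≫ Q.map

instance : Category.{u} PenMor.{u} where
  Hom := PenMor.Hom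
  id P :=
    { left := 𝟙 _
      right := 𝟙 _
      isBridge := fun h => h
      comm := by simp }
  comp f g :=
    { left := f.left ≫ g.left
      right := f.right ≫ g.right
      isBridge := fun h => g.isBridge (f.isBridge h)
      comm := by rw [← Category.assoc, f.comm, Category.assoc, g.comm, Category.assoc] }

/-- The functor `Pen_Mor ⥤ Omega_Graph` that sends a categorical Penon morphism to the omega
graph that underlies its domain. -/
abbrev PenMor.forget : PenMor.{u} ⥤ OmegaGraph.{u} where
  obj P := P.source.toOmegaGraph
  map f := OmegaMagma.forget.map f.left

/-! ### Weak omega categories -/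

/-- A weak omega category `X₁ ⇆ X₂ → X₃`. -/
structure WeakOmegaCat where
  X₁ : OmegaMagma.{u}
  X₂ : OmegaMagma.{u}
  lam : X₂ ⟶ X₁
  rho : OmegaMagma.forget.obj X₁ ⟶ OmegaMagma.forget.obj X₂
  split : rho ≫ OmegaMagma.forget.map lam = 𝟙 (OmegaMagma.forget.obj X₁)
  bridge : BridgeRelation X₂.toOmegaGraph
  X₃ : OmegaMagma.{u}
  kappa : X₂ ⟶ X₃
  /-- This includes that `X₃` is a strict omega category. -/
  isPenon : IsCategoricalPenon bridge kappa

/-- The categorical Penon morphism `κ : (X₂, R) → (X₃, R^Δ)` of a weak omega category. -/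
abbrev WeakOmegaCat.penMor (X : WeakOmegaCat.{u}) : PenMor.{u} where
  source := X.X₂
  bridge := X.bridge
  target := X.X₃
  map := X.kappa
  isPenon := X.isPenon

/-- Omega functors. -/
@[ext]
structure OmegaFunctor (X Y : WeakOmegaCat.{u}) where
  F₁ : X.X₁ ⟶ Y.X₁
  F₂ : X.X₂ ⟶ Y.X₂
  F₃ : X.X₃ ⟶ Y.X₃
  isBridge : IsBridgeMorphism X.bridge Y.bridge F₂
  comm_lam : X.lam ≫ F₁ = F₂ ≫ Y.lam
  comm_kappa : X.kappa ≫ F₃ = F₂ ≫ Y.kappa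
  comm_rho : X.rho ≫ OmegaMagma.forget.map F₂ = OmegaMagma.forget.map F₁ ≫ Y.rho

/-- `Omega_Cat`. -/
instance : Category.{u} WeakOmegaCat.{u} where
  Hom := OmegaFunctor
  id X :=
    { F₁ := 𝟙 _
      F₂ := 𝟙 _
      F₃ := 𝟙 _
      isBridge := fun h => h
      comm_lam := by simp
      comm_kappa := by simp
      comm_rho := by
        rw [CategoryTheory.Functor.map_id, CategoryTheory.Functor.map_id, Category.comp_id,
          Category.id_comp] }
  comp {X Y Z} f g :=
    { F₁ := f.F₁ ≫ g.F₁
      F₂ := f.F₂ ≫ g.F₂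
      F₃ := f.F₃ ≫ g.F₃
      isBridge := fun h => g.isBridge (f.isBridge h)
      comm_lam := by rw [← Category.assoc, f.comm_lam, Category.assoc, g.comm_lam, Category.assoc]
      comm_kappa := by
        rw [← Category.assoc, f.comm_kappa, Category.assoc, g.comm_kappa, Category.assoc]
      comm_rho := by
        have hf := f.comm_rho
        have hg := g.comm_rho
        rw [Functor.map_comp, Functor.map_comp, ← Category.assoc, hf, Category.assoc, hg,
          Category.assoc] }

/-- The morphism of categorical Penon morphisms `(F₂, F₃)` that is part of an omega functor. -/
def OmegaFunctor.penMorHom {X Y : WeakOmegaCat.{u}} (F : X ⟶ Y) : X.penMor ⟶ Y.penMor :=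
  PenMor.Hom.mk (P := X.penMor) (Q := Y.penMor) F.F₂ F.F₃ F.isBridge F.comm_kappa

/-! ### `Prolixe` and `Pen_Omega_Cat`

Everything below is relative to a left adjoint `L` of `PenMor.forget`, the free categorical Penon
morphism functor. -/

theorem OmegaGraph.Hom.map_domTo {X Y : OmegaGraph.{u}} (f : X ⟶ Y) {i j : ℕ} (h : i ≤ j)
    (x : X.cell j) : f.app (X.domTo h x) = Y.domTo h (f.app x) := by
  induction h with
  | refl => rw [GlobularSet.domTo_self, GlobularSet.domTo_self]
  | step h ih => rw [X.domTo_succ h, Y.domTo_succ h, ih, f.map_dom]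

theorem OmegaGraph.Hom.map_codTo {X Y : OmegaGraph.{u}} (f : X ⟶ Y) {i j : ℕ} (h : i ≤ j)
    (x : X.cell j) : f.app (X.codTo h x) = Y.codTo h (f.app x) := by
  induction h with
  | refl => rw [GlobularSet.codTo_self, GlobularSet.codTo_self]
  | step h ih => rw [X.codTo_succ h, Y.codTo_succ h, ih, f.map_cod]

theorem OmegaGraph.Hom.app_app_of_comp_eq_id {Y Z : OmegaGraph.{u}} {r : Y ⟶ Z} {l : Z ⟶ Y}
    (e : r ≫ l = 𝟙 Y) {n : ℕ} (x : Y.cell n) : l.app (r.app x) = x := by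
  have := congrArg (fun f : Y ⟶ Y => f.app x) e
  exact this

/-- An omega graph `Y` that is a retract (as an omega graph) of an omega magma `M`, by `l` and
its section `r`, is an omega magma with `a ∘ b = l (r a ∘ r b)`. -/
def OmegaMagma.ofRetract (Y : OmegaGraph.{u}) (M : OmegaMagma.{u}) (r : Y ⟶ M.toOmegaGraph)
    (l : M.toOmegaGraph ⟶ Y) (e : r ≫ l = 𝟙 Y) : OmegaMagma.{u} where
  toOmegaGraph := Y
  Comp h a b c := ∃ d, M.Comp h (r.app a) (r.app b) d ∧ l.app d = c
  comp_composable := by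
    rintro i j h a b c ⟨d, hd, -⟩
    have := M.comp_composable h hd
    rw [← r.map_codTo, ← r.map_domTo] at this
    have := congrArg l.app this
    rwa [OmegaGraph.Hom.app_app_of_comp_eq_id e, OmegaGraph.Hom.app_app_of_comp_eq_id e] at this
  comp_unique := by
    rintro i j h a b c c' ⟨d, hd, rfl⟩ ⟨d', hd', rfl⟩
    rw [M.comp_unique h hd hd']
  comp_exists := by
    intro i j h a b hab
    have := congrArg r.app hab
    rw [r.map_codTo, r.map_domTo] at this
    obtain ⟨d, hd⟩ := M.comp_exists h this
    exact ⟨_, d, hd, rfl⟩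
  comp_top := by
    rintro i a b c ⟨d, hd, rfl⟩
    obtain ⟨h1, h2⟩ := M.comp_top hd
    rw [← l.map_dom, ← l.map_cod, h1, h2, l.map_dom, l.map_cod]
    rw [OmegaGraph.Hom.app_app_of_comp_eq_id e, OmegaGraph.Hom.app_app_of_comp_eq_id e]
    exact ⟨rfl, rfl⟩
  comp_boundary := by
    rintro i j h a b c ⟨d, hd, rfl⟩
    obtain ⟨h1, h2⟩ := M.comp_boundary h hd
    exact ⟨⟨M.dom d, by rwa [r.map_dom, r.map_dom], l.map_dom d⟩,
      ⟨M.cod d, by rwa [r.map_cod, r.map_cod], l.map_cod d⟩⟩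

section

variable {L : OmegaGraph.{u} ⥤ PenMor.{u}} (adj : L ⊣ PenMor.forget.{u})

/-- `Prolixe`: the category of algebras for the monad induced by the adjunction. -/
abbrev Prolixe : Type (u + 1) := adj.toMonad.Algebra

/-- The objects of `Pen_Omega_Cat`, for `Y` the omega graph underlying `X₁`: the categorical
Penon morphism `κ` is `L Y`, and `ρ : Y ⟶ X₂` is the unit of the adjunction at `Y`. -/
def IsPenonWeak : ObjectProperty WeakOmegaCat.{u} := fun X =>
  ∃ e : X.penMor = L.obj X.X₁.toOmegaGraph,
    X.rho ≫ PenMor.forget.map (eqToHom e) = adj.unit.app X.X₁.toOmegaGraph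

/-- `Pen_Omega_Cat`, a full subcategory of `Omega_Cat`. -/
abbrev PenOmegaCat : Type (u + 1) := (IsPenonWeak adj).FullSubcategory

variable {adj}

/-- The structure morphism `M_P(Y) ⟶ Y` of an algebra `Y`. -/
abbrev Prolixe.act (A : Prolixe adj) : (L.obj A.A).source.toOmegaGraph ⟶ A.A := A.a

theorem Prolixe.unit_act (A : Prolixe adj) :
    (show A.A ⟶ (L.obj A.A).source.toOmegaGraph from adj.unit.app A.A) ≫ A.act = 𝟙 A.A :=
  A.unit

/-- The omega magma structure on an algebra. -/
def Prolixe.magma (A : Prolixe adj) : OmegaMagma.{u} :=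
  OmegaMagma.ofRetract A.A (L.obj A.A).source (adj.unit.app A.A) A.act A.unit_act

/-- The structure morphism of an algebra, as a morphism of omega magmas. -/
def Prolixe.lam (A : Prolixe adj) : (L.obj A.A).source ⟶ A.magma :=
  OmegaMagma.Hom.mk (X := (L.obj A.A).source) (Y := A.magma) A.act (by
    intro i j h a b c H
    let T : OmegaGraph.{u} ⥤ OmegaGraph.{u} := L ⋙ PenMor.forget
    let Z : OmegaGraph.{u} := T.obj A.A
    let r : Z ⟶ T.obj Z := adj.unit.app Z
    let m : (L.obj Z).source ⟶ (L.obj A.A).source := (adj.counit.app (L.obj A.A)).left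
    let t : (L.obj Z).source ⟶ (L.obj A.A).source := (L.map A.act).left
    have hm : ∀ {n : ℕ} (x : Z.cell n), m.app (r.app x) = x := fun x =>
      OmegaGraph.Hom.app_app_of_comp_eq_id (r := r) (l := PenMor.forget.map
        (adj.counit.app (L.obj A.A))) (adj.right_triangle_components (L.obj A.A)) x
    have ht : ∀ {n : ℕ} (x : Z.cell n), t.app (r.app x) =
        OmegaGraph.Hom.app (adj.unit.app A.A) (A.act.app x) := by
      intro n x
      have e : A.act ≫ adj.unit.app A.A = r ≫ T.map A.act := adj.unit.naturality A.act
      exact (congrArg (fun f : Z ⟶ T.obj A.A => f.app x) e).symm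
    have ha : ∀ {n : ℕ} (x : (T.obj Z).cell n), A.act.app (m.app x) = A.act.app (t.app x) := by
      intro n x
      exact congrArg (fun f : T.obj Z ⟶ A.A => f.app x) A.assoc
    have hab : (L.obj Z).source.codTo h.le (r.app a) = (L.obj Z).source.domTo h.le (r.app b) := by
      exact (r.map_codTo h.le a).symm.trans ((congrArg r.app
        ((L.obj A.A).source.comp_composable h H)).trans (r.map_domTo h.le b))
    obtain ⟨d, hd⟩ := (L.obj Z).source.comp_exists h hab
    refine ⟨t.app d, ?_, ?_⟩
    · have := t.map_comp h hd
      rwa [ht, ht] at this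
    · have := m.map_comp h hd
      rw [hm, hm] at this
      rw [← ha, (L.obj A.A).source.comp_unique h this H])

/-- The weak omega category of an algebra `h : M_P(Y) ⟶ Y`: its underlying magma is `Y`, its
`λ` is `h`, its `ρ` is the unit of the monad, and its `κ` is `L Y`. -/
def Prolixe.weak (A : Prolixe adj) : WeakOmegaCat.{u} where
  X₁ := A.magma
  X₂ := (L.obj A.A).source
  lam := A.lam
  rho := adj.unit.app A.A
  split := A.unit_act
  bridge := (L.obj A.A).bridge
  X₃ := (L.obj A.A).target
  kappa := (L.obj A.A).map
  isPenon := (L.obj A.A).isPenon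

theorem Prolixe.isPenonWeak (A : Prolixe adj) : IsPenonWeak adj A.weak :=
  ⟨rfl, (congrArg (fun g : PenMor.forget.obj (L.obj A.A) ⟶ PenMor.forget.obj (L.obj A.A) =>
    A.weak.rho ≫ g) (PenMor.forget.map_id (L.obj A.A))).trans (Category.comp_id _)⟩

/-- The omega functor of a morphism of algebras. -/
def Prolixe.weakMap {A B : Prolixe adj} (f : A ⟶ B) : A.weak ⟶ B.weak :=
  OmegaFunctor.mk (X := A.weak) (Y := B.weak)
    (OmegaMagma.Hom.mk (X := A.magma) (Y := B.magma) f.f (by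
      rintro i j h a b c ⟨d, hd, rfl⟩
      have hη : ∀ {n : ℕ} (x : A.A.cell n),
          (L.map f.f).left.app (OmegaGraph.Hom.app (adj.unit.app A.A) x) =
            OmegaGraph.Hom.app (adj.unit.app B.A) (f.f.app x) := fun x =>
        (congrArg (fun g : A.A ⟶ (L ⋙ PenMor.forget).obj B.A => g.app x)
          (adj.unit.naturality f.f)).symm
      refine ⟨(L.map f.f).left.app d, ?_, ?_⟩
      · have := (L.map f.f).left.map_comp h hd
        exact hη a ▸ hη b ▸ this
      · exact congrArg (fun g : (L ⋙ PenMor.forget).obj A.A ⟶ B.A => g.app d) f.h))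
    (L.map f.f).left (L.map f.f).right (L.map f.f).isBridge
    (OmegaMagma.Hom.ext (congrArg (fun g : (L ⋙ PenMor.forget).obj A.A ⟶ B.A =>
      @OmegaGraph.Hom.app _ _ g) f.h.symm))
    (L.map f.f).comm
    (adj.unit.naturality f.f).symm

variable (adj)

/-- The functor `S : Prolixe ⥤ Pen_Omega_Cat`. -/
def prolixeToPen : Prolixe adj ⥤ PenOmegaCat adj where
  obj A := ⟨A.weak, A.isPenonWeak⟩
  map f := ObjectProperty.homMk (Prolixe.weakMap f)
  map_id A := by
    apply ObjectProperty.hom_ext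
    have h := L.map_id A.A
    exact OmegaFunctor.ext (X := A.weak) (Y := A.weak) rfl (congrArg PenMor.Hom.left h)
      (congrArg PenMor.Hom.right h)
  map_comp {A B C} f g := by
    apply ObjectProperty.hom_ext
    have h := L.map_comp f.f g.f
    exact OmegaFunctor.ext (X := A.weak) (Y := C.weak) rfl (congrArg PenMor.Hom.left h)
      (congrArg PenMor.Hom.right h)

variable {adj}

theorem PenOmegaCat.penMor_eq (X : PenOmegaCat adj) :
    X.obj.penMor = L.obj X.obj.X₁.toOmegaGraph := X.property.choose

/-- `λ`, regarded as a morphism `T Y ⟶ Y` of omega graphs, where `T` is the monad and `Y` is the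
omega graph underlying `X₁`. -/
def PenOmegaCat.action (X : PenOmegaCat adj) :
    adj.toMonad.obj X.obj.X₁.toOmegaGraph ⟶ X.obj.X₁.toOmegaGraph :=
  PenMor.forget.map (eqToHom X.penMor_eq.symm) ≫ OmegaMagma.forget.map X.obj.lam

theorem PenOmegaCat.unit_eq (X : PenOmegaCat adj) :
    adj.unit.app X.obj.X₁.toOmegaGraph =
      X.obj.rho ≫ PenMor.forget.map (eqToHom X.penMor_eq) := X.property.choose_spec.symm

theorem PenOmegaCat.unit_action (X : PenOmegaCat adj) :
    adj.toMonad.η.app X.obj.X₁.toOmegaGraph ≫ X.action = 𝟙 X.obj.X₁.toOmegaGraph := by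
  have h1 : X.obj.rho ≫ PenMor.forget.map (eqToHom X.penMor_eq) ≫
      PenMor.forget.map (eqToHom X.penMor_eq.symm) ≫ OmegaMagma.forget.map X.obj.lam =
      𝟙 X.obj.X₁.toOmegaGraph := by
    rw [← PenMor.forget.map_comp_assoc, eqToHom_trans, eqToHom_refl, PenMor.forget.map_id]
    exact X.obj.split
  change adj.unit.app X.obj.X₁.toOmegaGraph ≫ _ = _
  rw [X.unit_eq]
  exact (Category.assoc _ _ _).trans h1

variable (adj)

/-- The objects of `Pen_Omega_Cat` whose `λ : T Y ⟶ Y` satisfies the associativity law of an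
algebra for the monad `T`. -/
def IsAssociative : ObjectProperty (PenOmegaCat adj) := fun X =>
  adj.toMonad.μ.app X.obj.X₁.toOmegaGraph ≫ X.action =
    adj.toMonad.map X.action ≫ X.action

variable {adj}

theorem PenOmegaCat.map_action {X Y : PenOmegaCat adj} (F : X ⟶ Y) :
    adj.toMonad.map (OmegaMagma.forget.map F.hom.F₁) ≫ Y.action =
      X.action ≫ OmegaMagma.forget.map F.hom.F₁ := by
  let g : X.obj.X₁.toOmegaGraph ⟶ Y.obj.X₁.toOmegaGraph := OmegaMagma.forget.map F.hom.F₁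
  let l : PenMor.forget.obj X.obj.penMor ⟶ X.obj.X₁.toOmegaGraph :=
    OmegaMagma.forget.map X.obj.lam
  let l' : PenMor.forget.obj Y.obj.penMor ⟶ Y.obj.X₁.toOmegaGraph :=
    OmegaMagma.forget.map Y.obj.lam
  let r : X.obj.X₁.toOmegaGraph ⟶ PenMor.forget.obj X.obj.penMor := X.obj.rho
  let r' : Y.obj.X₁.toOmegaGraph ⟶ PenMor.forget.obj Y.obj.penMor := Y.obj.rho
  let k : X.obj.penMor ⟶ Y.obj.penMor := F.hom.penMorHom
  have hu : adj.unit.app X.obj.X₁.toOmegaGraph =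
      r ≫ PenMor.forget.map (eqToHom X.penMor_eq) := X.unit_eq
  have hu' : adj.unit.app Y.obj.X₁.toOmegaGraph =
      r' ≫ PenMor.forget.map (eqToHom Y.penMor_eq) := Y.unit_eq
  have hr : r ≫ PenMor.forget.map k = g ≫ r' := F.hom.comm_rho
  have hl : l ≫ g = PenMor.forget.map k ≫ l' :=
    congrArg OmegaMagma.forget.map F.hom.comm_lam
  have key : L.map g = eqToHom X.penMor_eq.symm ≫ k ≫ eqToHom Y.penMor_eq := by
    apply (adj.homEquiv _ _).injective
    rw [adj.homEquiv_unit, adj.homEquiv_unit]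
    have hn : adj.unit.app X.obj.X₁.toOmegaGraph ≫ PenMor.forget.map (L.map g) =
        g ≫ adj.unit.app Y.obj.X₁.toOmegaGraph := (adj.unit.naturality g).symm
    rw [hn, hu, hu', Category.assoc, ← PenMor.forget.map_comp, eqToHom_trans_assoc,
      eqToHom_refl, Category.id_comp, PenMor.forget.map_comp, ← Category.assoc, ← Category.assoc,
      hr]
  change PenMor.forget.map (L.map g) ≫ PenMor.forget.map (eqToHom Y.penMor_eq.symm) ≫ l' =
    (PenMor.forget.map (eqToHom X.penMor_eq.symm) ≫ l) ≫ g
  rw [key, Category.assoc, hl, ← PenMor.forget.map_comp_assoc, ← PenMor.forget.map_comp_assoc]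
  simp only [Category.assoc, eqToHom_trans, eqToHom_refl, Category.comp_id]

/-- The functor that sends `X` to the algebra `λ : T Y ⟶ Y`, and an omega functor `F` to the
morphism of omega graphs that underlies `F₁`. -/
def associativeToProlixe : (IsAssociative adj).FullSubcategory ⥤ Prolixe adj where
  obj X :=
    { A := X.obj.obj.X₁.toOmegaGraph
      a := X.obj.action
      unit := X.obj.unit_action
      assoc := X.property }
  map F :=
    { f := OmegaMagma.forget.map F.hom.hom.F₁
      h := PenOmegaCat.map_action F.hom }

end

end WeakOmega

universe v

namespace WeakOmega

/-! Both halves rest on one construction. A universal structure under an omega graph should be a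
subobject of the product of all structures under it, but that product has a large index type. It is
cut down to the families of cells that are, at all indices at once, the values of one formal term.
Terms over a small graph form a small type, and a term has at most one value at each index, so these
families form a small structure. The laws hold componentwise, and closure under the operations is
built into the terms. The structure so obtained is itself one of the indices, and its projection to
that index is the identity. Hence each of its cells is the value of a term in the structure itself,
and morphisms out of it are determined by the generators.

Applied to categorical Penon morphisms under `Y`, this yields the free one (`UnderPenMor.free`), an
initial object of the comma category, and so the left adjoint.

For the retraction, let `X` be in `PenOmegaCat adj`, with underlying graph `G`. Its `λ` gives an
action `T G ⟶ G` that obeys the unit law but perhaps not associativity, and omega functors commute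
with these actions (`PenOmegaCat.map_action`). The functor `U` sends `X` to the universal algebra
receiving a graph morphism from `G` that commutes with the actions. It is built by the same method.
The new point is that the subgraph of term values is closed under the action, which holds because
the cells of any free categorical Penon morphism are values of terms (`exists_eval_unit`), into
which terms for the generators can be substituted (`exists_algTerm`). An algebra is its own
reflection, and choosing that reflection whenever `λ` is associative turns the required isomorphisms
into equalities. -/

/-! ### Iterated identities and extensionality of morphisms -/

theorem OmegaGraph.identTo_self (X : OmegaGraph.{u}) {i : ℕ} (x : X.cell i) :
    X.identTo (le_refl i) x = x := by
  simp [identTo, Nat.leRec_self]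

theorem OmegaGraph.identTo_succ (X : OmegaGraph.{u}) {i j : ℕ} (h : i ≤ j) (x : X.cell i) :
    X.identTo (Nat.le_succ_of_le h) x = X.ident (X.identTo h x) := by
  rw [identTo, Nat.leRec_succ _ _ h]; rfl

theorem OmegaGraph.Hom.map_identTo {X Y : OmegaGraph.{u}} (f : X ⟶ Y) {i j : ℕ} (h : i ≤ j)
    (x : X.cell i) : f.app (X.identTo h x) = Y.identTo h (f.app x) := by
  induction h with
  | refl => rw [OmegaGraph.identTo_self, OmegaGraph.identTo_self]
  | step h ih => rw [X.identTo_succ h, Y.identTo_succ h, f.map_ident, ih]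

theorem OmegaGraph.hom_ext {X Y : OmegaGraph.{u}} {f g : X ⟶ Y}
    (h : ∀ {n : ℕ} (x : X.cell n), f.app x = g.app x) : f = g :=
  OmegaGraph.Hom.ext (by funext n x; exact h x)

theorem OmegaGraph.congr_app {X Y : OmegaGraph.{u}} {f g : X ⟶ Y} (h : f = g) {n : ℕ}
    (x : X.cell n) : f.app x = g.app x := by rw [h]

theorem OmegaMagma.hom_ext {X Y : OmegaMagma.{u}} {f g : X ⟶ Y}
    (h : ∀ {n : ℕ} (x : X.cell n), f.app x = g.app x) : f = g :=
  OmegaMagma.Hom.ext (by funext n x; exact h x)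

/-! ### Small subgraphs of large products -/

/-- A small subgraph of a possibly large product of omega graphs. -/
structure SmallSubgraph {ι : Type v} (G : ι → OmegaGraph.{u}) where
  Mem : ∀ {n : ℕ}, (∀ i, (G i).cell n) → Prop
  small : ∀ n : ℕ, Small.{u} { s : ∀ i, (G i).cell n // Mem s }
  mem_dom : ∀ {n : ℕ} {s : ∀ i, (G i).cell (n + 1)}, Mem s → Mem fun i => (G i).dom (s i)
  mem_cod : ∀ {n : ℕ} {s : ∀ i, (G i).cell (n + 1)}, Mem s → Mem fun i => (G i).cod (s i)
  mem_ident : ∀ {n : ℕ} {s : ∀ i, (G i).cell n}, Mem s → Mem fun i => (G i).ident (s i)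

namespace SmallSubgraph

variable {ι : Type v} {G : ι → OmegaGraph.{u}} (S : SmallSubgraph G)

attribute [instance] SmallSubgraph.small

/-- The cells of a small subgraph. -/
def Cell (n : ℕ) : Type u := Shrink.{u} { s : ∀ i, (G i).cell n // S.Mem s }

variable {S}

/-- The components of a cell. -/
noncomputable def Cell.val {n : ℕ} (x : S.Cell n) (i : ι) : (G i).cell n :=
  ((equivShrink _).symm x).1 i

theorem Cell.mem {n : ℕ} (x : S.Cell n) : S.Mem x.val :=
  ((equivShrink _).symm x).2

/-- The cell with given components. -/
noncomputable def Cell.mk {n : ℕ} (s : ∀ i, (G i).cell n) (h : S.Mem s) : S.Cell n :=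
  equivShrink _ ⟨s, h⟩

@[simp]
theorem Cell.val_mk {n : ℕ} (s : ∀ i, (G i).cell n) (h : S.Mem s) (i : ι) :
    (Cell.mk s h).val i = s i := by
  simp [Cell.mk, Cell.val]

theorem Cell.ext {n : ℕ} {x y : S.Cell n} (h : ∀ i, x.val i = y.val i) : x = y :=
  (equivShrink _).symm.injective (Subtype.ext (funext h))

variable (S)

/-- A small subgraph, as an omega graph. -/
noncomputable def toGraph : OmegaGraph.{u} where
  cell := S.Cell
  dom x := Cell.mk _ (S.mem_dom x.mem)
  cod x := Cell.mk _ (S.mem_cod x.mem)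
  dom_dom x := Cell.ext fun i => by simp [(G i).dom_dom]
  cod_dom x := Cell.ext fun i => by simp [(G i).cod_dom]
  ident x := Cell.mk _ (S.mem_ident x.mem)
  dom_ident x := Cell.ext fun i => by simp [(G i).dom_ident]
  cod_ident x := Cell.ext fun i => by simp [(G i).cod_ident]

/-- The projections of a small subgraph. -/
noncomputable def proj (i : ι) : S.toGraph ⟶ G i :=
  OmegaGraph.Hom.mk (X := S.toGraph) (Y := G i) (fun x => Cell.val x i)
    (fun _ => Cell.val_mk _ _ _) (fun _ => Cell.val_mk _ _ _) (fun _ => Cell.val_mk _ _ _)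

variable {S}

theorem ext {n : ℕ} {x y : S.toGraph.cell n} (h : ∀ i, (S.proj i).app x = (S.proj i).app y) :
    x = y := Cell.ext h

theorem mem {n : ℕ} (x : S.toGraph.cell n) : S.Mem fun i => (S.proj i).app x := Cell.mem x

theorem exists_proj {n : ℕ} {s : ∀ i, (G i).cell n} (h : S.Mem s) :
    ∃ x : S.toGraph.cell n, ∀ i, (S.proj i).app x = s i :=
  ⟨Cell.mk s h, Cell.val_mk s h⟩

theorem hom_ext {Z : OmegaGraph.{u}} {f g : Z ⟶ S.toGraph}
    (h : ∀ i, f ≫ S.proj i = g ≫ S.proj i) : f = g :=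
  OmegaGraph.hom_ext fun x => ext fun i => OmegaGraph.congr_app (h i) x

/-- The morphism to a small subgraph with given components. -/
noncomputable def lift {Z : OmegaGraph.{u}} (g : ∀ i, Z ⟶ G i)
    (h : ∀ (n : ℕ) (x : Z.cell n), S.Mem fun i => (g i).app x) : Z ⟶ S.toGraph :=
  OmegaGraph.Hom.mk (X := Z) (Y := S.toGraph) (fun x => Cell.mk _ (h _ x))
    (fun x => Cell.ext fun i => by
      refine (Cell.val_mk _ _ _).trans (((g i).map_dom x).trans ?_)
      exact ((Cell.val_mk _ _ _).trans (congrArg _ (Cell.val_mk _ _ _))).symm)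
    (fun x => Cell.ext fun i => by
      refine (Cell.val_mk _ _ _).trans (((g i).map_cod x).trans ?_)
      exact ((Cell.val_mk _ _ _).trans (congrArg _ (Cell.val_mk _ _ _))).symm)
    (fun x => Cell.ext fun i => by
      refine (Cell.val_mk _ _ _).trans (((g i).map_ident x).trans ?_)
      exact ((Cell.val_mk _ _ _).trans (congrArg _ (Cell.val_mk _ _ _))).symm)

theorem proj_lift {Z : OmegaGraph.{u}} (g : ∀ i, Z ⟶ G i)
    (h : ∀ (n : ℕ) (x : Z.cell n), S.Mem fun i => (g i).app x) {n : ℕ} (x : Z.cell n) (i : ι) :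
    (S.proj i).app ((lift g h).app x) = (g i).app x :=
  Cell.val_mk _ _ _

theorem lift_proj {Z : OmegaGraph.{u}} (g : ∀ i, Z ⟶ G i)
    (h : ∀ (n : ℕ) (x : Z.cell n), S.Mem fun i => (g i).app x) (i : ι) :
    lift g h ≫ S.proj i = g i :=
  OmegaGraph.hom_ext fun x => proj_lift g h x i

theorem parallel {n : ℕ} {a b : S.toGraph.cell n}
    (h : ∀ i, (G i).Parallel ((S.proj i).app a) ((S.proj i).app b)) : S.toGraph.Parallel a b := by
  cases n with
  | zero => trivial
  | succ n =>
    refine ⟨ext fun i => ?_, ext fun i => ?_⟩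
    · rw [(S.proj i).map_dom, (S.proj i).map_dom]; exact (h i).1
    · rw [(S.proj i).map_cod, (S.proj i).map_cod]; exact (h i).2

end SmallSubgraph

theorem OmegaGraph.Hom.map_parallel {X Y : OmegaGraph.{u}} (f : X ⟶ Y) {n : ℕ} {a b : X.cell n}
    (h : X.Parallel a b) : Y.Parallel (f.app a) (f.app b) := by
  cases n with
  | zero => trivial
  | succ n => exact ⟨by rw [← f.map_dom, ← f.map_dom, h.1], by rw [← f.map_cod, ← f.map_cod, h.2]⟩

/-- A small submagma of a possibly large product of omega magmas. -/
structure SmallSubmagma {ι : Type v} (M : ι → OmegaMagma.{u}) extends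
    SmallSubgraph fun i => (M i).toOmegaGraph where
  mem_comp : ∀ {i j : ℕ} (h : i < j) {a b c : ∀ k, (M k).cell j}, Mem a → Mem b →
    (∀ k, (M k).Comp h (a k) (b k) (c k)) → Mem c

namespace SmallSubmagma

variable {ι : Type v} {M : ι → OmegaMagma.{u}} (S : SmallSubmagma M)

/-- A small submagma, as an omega magma. -/
noncomputable def toMagma : OmegaMagma.{u} where
  toOmegaGraph := S.toGraph
  Comp h a b c := ∀ k, (M k).Comp h ((S.proj k).app a) ((S.proj k).app b) ((S.proj k).app c)
  comp_composable h a b c H := S.ext fun k => by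
    rw [(S.proj k).map_codTo, (S.proj k).map_domTo]; exact (M k).comp_composable h (H k)
  comp_unique h a b c d H H' := S.ext fun k => (M k).comp_unique h (H k) (H' k)
  comp_exists h a b H := by
    have hc : ∀ k, ∃ c, (M k).Comp h ((S.proj k).app a) ((S.proj k).app b) c := fun k =>
      (M k).comp_exists h (by rw [← (S.proj k).map_codTo, ← (S.proj k).map_domTo, H])
    choose c hc using hc
    obtain ⟨x, hx⟩ := S.exists_proj (S.mem_comp h (S.mem a) (S.mem b) hc)
    exact ⟨x, fun k => by rw [hx]; exact hc k⟩
  comp_top H := by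
    refine ⟨S.ext fun k => ?_, S.ext fun k => ?_⟩
    · rw [(S.proj k).map_dom, (S.proj k).map_dom]; exact ((M k).comp_top (H k)).1
    · rw [(S.proj k).map_cod, (S.proj k).map_cod]; exact ((M k).comp_top (H k)).2
  comp_boundary h a b c H := by
    refine ⟨fun k => ?_, fun k => ?_⟩
    · rw [(S.proj k).map_dom, (S.proj k).map_dom, (S.proj k).map_dom]
      exact ((M k).comp_boundary h (H k)).1
    · rw [(S.proj k).map_cod, (S.proj k).map_cod, (S.proj k).map_cod]
      exact ((M k).comp_boundary h (H k)).2

/-- The projections of a small submagma. -/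
noncomputable def magmaProj (k : ι) : S.toMagma ⟶ M k :=
  OmegaMagma.Hom.mk (X := S.toMagma) (Y := M k) (S.proj k) fun _ _ _ _ H => H k

/-- Composition is defined componentwise and the projections are jointly injective, so every law can
be checked in each factor. -/
theorem isStrict (h : ∀ k, (M k).IsStrict) : S.toMagma.IsStrict where
  assoc hij _ _ _ _ _ _ _ h₁ h₂ h₃ h₄ :=
    S.ext fun k => (h k).assoc hij (h₁ k) (h₂ k) (h₃ k) (h₄ k)
  interchange hij hjk _ _ _ _ _ _ _ _ _ _ h₁ h₂ h₃ h₄ h₅ h₆ :=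
    S.ext fun k => (h k).interchange hij hjk (h₁ k) (h₂ k) (h₃ k) (h₄ k) (h₅ k) (h₆ k)
  ident_comp hij (a : S.toGraph.cell _) k := by
    change (M k).Comp hij ((S.proj k).app (S.toGraph.identTo hij.le (S.toGraph.domTo hij.le a)))
      ((S.proj k).app a) ((S.proj k).app a)
    rw [(S.proj k).map_identTo, (S.proj k).map_domTo]
    exact (h k).ident_comp hij _
  comp_ident hij (a : S.toGraph.cell _) k := by
    change (M k).Comp hij ((S.proj k).app a)
      ((S.proj k).app (S.toGraph.identTo hij.le (S.toGraph.codTo hij.le a))) ((S.proj k).app a)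
    rw [(S.proj k).map_identTo, (S.proj k).map_codTo]
    exact (h k).comp_ident hij _
  ident_interchange hij (a b c : S.toGraph.cell _) H k := by
    change (M k).Comp _ ((S.proj k).app (S.toGraph.ident a)) ((S.proj k).app (S.toGraph.ident b))
      ((S.proj k).app (S.toGraph.ident c))
    rw [(S.proj k).map_ident, (S.proj k).map_ident, (S.proj k).map_ident]
    exact (h k).ident_interchange hij (H k)

/-- The componentwise bridge relation on a small submagma. -/
def bridge (R : ∀ k, BridgeRelation (M k).toOmegaGraph) :
    BridgeRelation S.toMagma.toOmegaGraph where
  Rel a b c := ∀ k, (R k).Rel ((S.proj k).app a) ((S.proj k).app b) ((S.proj k).app c)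
  boundary H := by
    refine ⟨S.parallel fun k => ((R k).boundary (H k)).1, S.ext fun k => ?_, S.ext fun k => ?_⟩
    · exact ((S.proj k).map_dom _).trans ((R k).boundary (H k)).2.1
    · exact ((S.proj k).map_cod _).trans ((R k).boundary (H k)).2.2
  refl (a : S.toGraph.cell _) k := by
    change (R k).Rel ((S.proj k).app a) ((S.proj k).app a) ((S.proj k).app (S.toGraph.ident a))
    rw [(S.proj k).map_ident]
    exact (R k).refl _
  unique H H' := S.ext fun k => (R k).unique (H k) (H' k)

end SmallSubmagma

/-! ### Formal terms -/

/-- Formal terms over an omega graph in the operations of omega magmas with bridges. -/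
inductive Term (Y : OmegaGraph.{u}) : ℕ → Type u
  | gen {n : ℕ} (y : Y.cell n) : Term Y n
  -- Boundaries are formal operations too, so that the values are closed under them without
  -- computing the boundary of a composite or a bridge.
  | dom {n : ℕ} (t : Term Y (n + 1)) : Term Y n
  | cod {n : ℕ} (t : Term Y (n + 1)) : Term Y n
  | ident {n : ℕ} (t : Term Y n) : Term Y (n + 1)
  | comp {i j : ℕ} (h : i < j) (s t : Term Y j) : Term Y j
  | bridge {n : ℕ} (s t : Term Y n) : Term Y (n + 1)

namespace Term

variable {Y : OmegaGraph.{u}}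

/-- `Eval R f t x` means that the term `t` is defined, with value `x`, if the generators are
interpreted by `f` and the bridges by `R`. -/
def Eval {M : OmegaMagma.{u}} (R : BridgeRelation M.toOmegaGraph) (f : Y ⟶ M.toOmegaGraph) :
    ∀ {n : ℕ}, Term Y n → M.cell n → Prop
  | _, gen y, x => x = f.app y
  | _, dom t, x => ∃ a, Eval R f t a ∧ x = M.dom a
  | _, cod t, x => ∃ a, Eval R f t a ∧ x = M.cod a
  | _, ident t, x => ∃ a, Eval R f t a ∧ x = M.ident a
  | _, comp h s t, x => ∃ a b, Eval R f s a ∧ Eval R f t b ∧ M.Comp h a b x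
  | _, bridge s t, x => ∃ a b, Eval R f s a ∧ Eval R f t b ∧ R.Rel a b x

theorem Eval.unique {M : OmegaMagma.{u}} {R : BridgeRelation M.toOmegaGraph}
    {f : Y ⟶ M.toOmegaGraph} {n : ℕ} {t : Term Y n} {x y : M.cell n} (hx : Eval R f t x)
    (hy : Eval R f t y) : x = y := by
  induction t with
  | gen z => exact hx.trans hy.symm
  | dom t ih | cod t ih | ident t ih =>
    obtain ⟨a, ha, rfl⟩ := hx
    obtain ⟨b, hb, rfl⟩ := hy
    rw [ih ha hb]
  | comp h s t ihs iht =>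
    obtain ⟨a, b, ha, hb, hx⟩ := hx
    obtain ⟨a', b', ha', hb', hy⟩ := hy
    obtain rfl := ihs ha ha'
    obtain rfl := iht hb hb'
    exact M.comp_unique h hx hy
  | bridge s t ihs iht =>
    obtain ⟨a, b, ha, hb, hx⟩ := hx
    obtain ⟨a', b', ha', hb', hy⟩ := hy
    obtain rfl := ihs ha ha'
    obtain rfl := iht hb hb'
    exact R.unique hx hy

/-- The operations are partial, and a morphism carries defined values to defined values. With
`Eval.unique`, this makes two morphisms that agree on generators agree on every value of a term. -/
theorem Eval.map {M N : OmegaMagma.{u}} {R : BridgeRelation M.toOmegaGraph}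
    {S : BridgeRelation N.toOmegaGraph} {g : M ⟶ N} (hg : IsBridgeMorphism R S g)
    {f : Y ⟶ M.toOmegaGraph} {f' : Y ⟶ N.toOmegaGraph}
    (hf : ∀ {n : ℕ} (y : Y.cell n), g.app (f.app y) = f'.app y) {n : ℕ} {t : Term Y n}
    {x : M.cell n} (hx : Eval R f t x) : Eval S f' t (g.app x) := by
  induction t with
  | gen z => obtain rfl := hx; exact hf z
  | dom t ih => obtain ⟨a, ha, rfl⟩ := hx; exact ⟨_, ih ha, g.map_dom a⟩
  | cod t ih => obtain ⟨a, ha, rfl⟩ := hx; exact ⟨_, ih ha, g.map_cod a⟩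
  | ident t ih => obtain ⟨a, ha, rfl⟩ := hx; exact ⟨_, ih ha, g.map_ident a⟩
  | comp h s t ihs iht =>
    obtain ⟨a, b, ha, hb, hx⟩ := hx
    exact ⟨_, _, ihs ha, iht hb, g.map_comp h hx⟩
  | bridge s t ihs iht =>
    obtain ⟨a, b, ha, hb, hx⟩ := hx
    exact ⟨_, _, ihs ha, iht hb, hg hx⟩

/-- The families of cells, in a family of omega magmas with bridges, that are the values of a
single term. -/
def submagma {ι : Type v} (M : ι → OmegaMagma.{u}) (R : ∀ i, BridgeRelation (M i).toOmegaGraph)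
    (f : ∀ i, Y ⟶ (M i).toOmegaGraph) : SmallSubmagma M where
  Mem {n} s := ∃ t : Term Y n, ∀ i, Eval (R i) (f i) t (s i)
  small n := by
    -- A chosen term determines its family, since its value at each index is unique.
    refine small_of_injective (β := Term Y n) (f := fun s => s.2.choose) fun s s' h => ?_
    have h₁ := s.2.choose_spec
    have h₂ := s'.2.choose_spec
    replace h : s.2.choose = s'.2.choose := h
    rw [← h] at h₂
    exact Subtype.ext (funext fun i => (h₁ i).unique (h₂ i))
  mem_dom := fun ⟨t, ht⟩ => ⟨t.dom, fun i => ⟨_, ht i, rfl⟩⟩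
  mem_cod := fun ⟨t, ht⟩ => ⟨t.cod, fun i => ⟨_, ht i, rfl⟩⟩
  mem_ident := fun ⟨t, ht⟩ => ⟨t.ident, fun i => ⟨_, ht i, rfl⟩⟩
  mem_comp h := fun ⟨s, hs⟩ ⟨t, ht⟩ H => ⟨comp h s t, fun i => ⟨_, _, hs i, ht i, H i⟩⟩

end Term

/-! ### Free categorical Penon morphisms -/

theorem OmegaMagma.Hom.isBridgeMorphism_diagonal {X Y : OmegaMagma.{u}} (F : X ⟶ Y) :
    IsBridgeMorphism (BridgeRelation.diagonal X.toOmegaGraph)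
      (BridgeRelation.diagonal Y.toOmegaGraph) F := by
  rintro n a b c ⟨rfl, rfl⟩
  exact ⟨rfl, F.map_ident a⟩

/-- A categorical Penon morphism under an omega graph. -/
structure UnderPenMor (Y : OmegaGraph.{u}) where
  pen : PenMor.{u}
  gen : Y ⟶ PenMor.forget.obj pen

namespace UnderPenMor

variable (Y : OmegaGraph.{u})

/-- The source of the free categorical Penon morphism. -/
def freeSource : SmallSubmagma fun q : UnderPenMor Y => q.pen.source :=
  Term.submagma _ (fun q => q.pen.bridge) fun q => q.gen

/-- The target of the free categorical Penon morphism. -/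
def freeTarget : SmallSubmagma fun q : UnderPenMor Y => q.pen.target :=
  Term.submagma _ (fun q => BridgeRelation.diagonal q.pen.target.toOmegaGraph)
    fun q => q.gen ≫ OmegaMagma.forget.map q.pen.map

/-- The graph morphism underlying the free categorical Penon morphism. -/
noncomputable def freeGraphMap : (freeSource Y).toGraph ⟶ (freeTarget Y).toGraph :=
  SmallSubgraph.lift (fun q => (freeSource Y).proj q ≫ OmegaMagma.forget.map q.pen.map) fun _ x => by
    -- The same term witnesses the image: in the target its formal bridges are read in the diagonal
    -- relation, which `q.pen.map` respects.
    obtain ⟨t, ht⟩ := (freeSource Y).mem x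
    exact ⟨t, fun q => (ht q).map q.pen.isPenon.isBridge fun _ => rfl⟩

theorem proj_freeGraphMap {n : ℕ} (x : (freeSource Y).toGraph.cell n) (q : UnderPenMor Y) :
    ((freeTarget Y).proj q).app ((freeGraphMap Y).app x) =
      q.pen.map.app (((freeSource Y).proj q).app x) :=
  SmallSubgraph.proj_lift _ _ _ _

/-- The free categorical Penon morphism, as a morphism of omega magmas. -/
noncomputable def freeMap : (freeSource Y).toMagma ⟶ (freeTarget Y).toMagma :=
  OmegaMagma.Hom.mk (X := (freeSource Y).toMagma) (Y := (freeTarget Y).toMagma) (freeGraphMap Y)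
    fun h (a b c : (freeSource Y).toGraph.cell _) H q => by
      have := q.pen.map.map_comp h (H q)
      rw [← proj_freeGraphMap, ← proj_freeGraphMap, ← proj_freeGraphMap] at this
      exact this

theorem isCategoricalPenon_freeMap :
    IsCategoricalPenon ((freeSource Y).bridge fun q => q.pen.bridge) (freeMap Y) := by
  have hc : ∀ {n : ℕ} {a b : (freeSource Y).toGraph.cell n}
      {c : (freeSource Y).toGraph.cell (n + 1)},
      (∀ q : UnderPenMor Y, q.pen.bridge.Rel (((freeSource Y).proj q).app a)
        (((freeSource Y).proj q).app b) (((freeSource Y).proj q).app c)) →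
      (freeGraphMap Y).app a = (freeGraphMap Y).app b ∧
        (freeGraphMap Y).app c = (freeTarget Y).toGraph.ident ((freeGraphMap Y).app a) := by
    intro n a b c H
    refine ⟨(freeTarget Y).ext fun q => ?_, (freeTarget Y).ext fun q => ?_⟩
    · rw [proj_freeGraphMap, proj_freeGraphMap]
      exact (q.pen.isPenon.collapse (H q)).1
    · rw [((freeTarget Y).proj q).map_ident, proj_freeGraphMap, proj_freeGraphMap]
      exact (q.pen.isPenon.collapse (H q)).2.1
  refine ⟨fun H => hc H, (freeTarget Y).isStrict fun q => q.pen.isPenon.strict, fun H => ?_, ?_⟩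
  · obtain ⟨h₁, h₂⟩ := hc H
    exact ⟨h₁, h₂, h₂.trans (congrArg _ h₁)⟩
  · intro n (a : (freeSource Y).toGraph.cell n) (b : (freeSource Y).toGraph.cell n) hab e
    have he : ∀ q : UnderPenMor Y, ∃ c, q.pen.bridge.Rel (((freeSource Y).proj q).app a)
        (((freeSource Y).proj q).app b) c := fun q => by
      refine q.pen.isPenon.bridge_exists (((freeSource Y).proj q).map_parallel hab) ?_
      rw [← proj_freeGraphMap, ← proj_freeGraphMap]
      exact congrArg ((freeTarget Y).proj q).app e
    choose c hc using he
    -- The bridges chosen separately at each index are all values of the single term `s.bridge t`,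
    -- so they form a cell of the free source.
    obtain ⟨s, hs⟩ := (freeSource Y).mem a
    obtain ⟨t, ht⟩ := (freeSource Y).mem b
    obtain ⟨x, hx⟩ := (freeSource Y).exists_proj (s := c)
      ⟨s.bridge t, fun q => ⟨_, _, hs q, ht q, hc q⟩⟩
    exact ⟨x, fun q => by rw [hx]; exact hc q⟩

/-- The free categorical Penon morphism on an omega graph. -/
noncomputable def freePen : PenMor.{u} where
  source := (freeSource Y).toMagma
  bridge := (freeSource Y).bridge fun q => q.pen.bridge
  target := (freeTarget Y).toMagma
  map := freeMap Y
  isPenon := isCategoricalPenon_freeMap Y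

/-- The free categorical Penon morphism with its generators. -/
noncomputable def free : UnderPenMor Y where
  pen := freePen Y
  gen := SmallSubgraph.lift (fun q => q.gen) fun _ y => ⟨Term.gen y, fun _ => rfl⟩

variable {Y}

/-- The morphism from the free categorical Penon morphism to a given one. -/
noncomputable def desc (q : UnderPenMor Y) : freePen Y ⟶ q.pen :=
  PenMor.Hom.mk (P := freePen Y) (Q := q.pen) ((freeSource Y).magmaProj q)
    ((freeTarget Y).magmaProj q) (fun H => H q)
    (OmegaMagma.hom_ext fun x => proj_freeGraphMap Y x q)

theorem desc_gen (q : UnderPenMor Y) {n : ℕ} (y : Y.cell n) :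
    q.desc.left.app ((free Y).gen.app y) = q.gen.app y :=
  SmallSubgraph.proj_lift _ _ _ _

theorem gen_desc (q : UnderPenMor Y) : (free Y).gen ≫ PenMor.forget.map q.desc = q.gen :=
  OmegaGraph.hom_ext fun y => q.desc_gen y

/-- Membership gives a term with values in all the factors; the free object is one of these factors,
so the term also has a value inside it. -/
theorem exists_eval_source {n : ℕ} (x : (freePen Y).source.cell n) :
    ∃ t : Term Y n, Term.Eval (freePen Y).bridge (free Y).gen t x := by
  obtain ⟨t, ht⟩ := (freeSource Y).mem x
  refine ⟨t, ?_⟩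
  -- The projection to the factor `free Y` is the identity: at each index `q`, both sides have as
  -- component the value of `t` at `q`.
  have h : x = (free Y).desc.left.app x := (freeSource Y).ext fun q =>
    (ht q).unique ((ht (free Y)).map q.desc.isBridge fun y => q.desc_gen y)
  rw [h]
  exact ht (free Y)

theorem exists_eval_target {n : ℕ} (x : (freePen Y).target.cell n) :
    ∃ t : Term Y n, Term.Eval (BridgeRelation.diagonal (freePen Y).target.toOmegaGraph)
      ((free Y).gen ≫ OmegaMagma.forget.map (freePen Y).map) t x := by
  obtain ⟨t, ht⟩ := (freeTarget Y).mem x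
  refine ⟨t, ?_⟩
  have h : x = (free Y).desc.right.app x := (freeTarget Y).ext fun q =>
    (ht q).unique ((ht (free Y)).map (OmegaMagma.Hom.isBridgeMorphism_diagonal q.desc.right)
      fun y => (OmegaGraph.congr_app (congrArg OmegaMagma.forget.map q.desc.comm)
        ((free Y).gen.app y)).trans (congrArg q.pen.map.app (q.desc_gen y)))
  rw [h]
  exact ht (free Y)

theorem hom_ext {Q : PenMor.{u}} {f g : freePen Y ⟶ Q}
    (h : (free Y).gen ≫ PenMor.forget.map f = (free Y).gen ≫ PenMor.forget.map g) : f = g := by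
  have h' : ∀ {n : ℕ} (y : Y.cell n),
      g.left.app ((free Y).gen.app y) = f.left.app ((free Y).gen.app y) :=
    fun y => (OmegaGraph.congr_app h y).symm
  have hc : ∀ (k : freePen Y ⟶ Q) {n : ℕ} (y : (freePen Y).source.cell n),
      k.right.app ((freePen Y).map.app y) = Q.map.app (k.left.app y) :=
    fun k _ y => OmegaGraph.congr_app (congrArg OmegaMagma.forget.map k.comm) y
  refine PenMor.Hom.ext (OmegaMagma.hom_ext fun x => ?_) (OmegaMagma.hom_ext fun x => ?_)
  · obtain ⟨t, ht⟩ := exists_eval_source x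
    exact (ht.map f.isBridge (f' := (free Y).gen ≫ PenMor.forget.map f) fun _ => rfl).unique
      (ht.map g.isBridge h')
  · obtain ⟨t, ht⟩ := exists_eval_target x
    -- By commutativity of the squares, both right components interpret the generators through the
    -- source, where `f` and `g` agree.
    refine (ht.map (OmegaMagma.Hom.isBridgeMorphism_diagonal f.right)
      (f' := (free Y).gen ≫ PenMor.forget.map f ≫ OmegaMagma.forget.map Q.map)
      fun y => hc f _).unique
      (ht.map (OmegaMagma.Hom.isBridgeMorphism_diagonal g.right) fun y => ?_)
    exact (hc g _).trans (congrArg Q.map.app (h' y))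

end UnderPenMor

theorem PenMor.isRightAdjoint_forget : PenMor.forget.{u}.IsRightAdjoint := by
  have : ∀ Y, Limits.HasInitial (StructuredArrow Y PenMor.forget.{u}) := fun Y => by
    let T : StructuredArrow Y PenMor.forget.{u} := StructuredArrow.mk (UnderPenMor.free Y).gen
    have : ∀ A : StructuredArrow Y PenMor.forget.{u}, Nonempty (T ⟶ A) := fun A =>
      ⟨StructuredArrow.homMk (UnderPenMor.desc ⟨A.right, A.hom⟩) (UnderPenMor.gen_desc _)⟩
    have : ∀ A : StructuredArrow Y PenMor.forget.{u}, Subsingleton (T ⟶ A) := fun A =>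
      ⟨fun f g => StructuredArrow.hom_ext _ _ (UnderPenMor.hom_ext
        ((StructuredArrow.w f).trans (StructuredArrow.w g).symm))⟩
    exact Limits.hasInitial_of_unique T
  exact isRightAdjointOfStructuredArrowInitials _

/-- The cells of any free categorical Penon morphism are the values of formal terms. -/
theorem exists_eval_unit {L : OmegaGraph.{u} ⥤ PenMor.{u}} (adj : L ⊣ PenMor.forget.{u})
    (Y : OmegaGraph.{u}) {n : ℕ} (x : (L.obj Y).source.cell n) :
    ∃ t : Term Y n, Term.Eval (L.obj Y).bridge (adj.unit.app Y) t x := by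
  let q : UnderPenMor Y := ⟨L.obj Y, adj.unit.app Y⟩
  let g : L.obj Y ⟶ UnderPenMor.freePen Y := (adj.homEquiv _ _).symm (UnderPenMor.free Y).gen
  -- Freeness of `L.obj Y` makes it a retract of the constructed free object, so terms for cells of
  -- the latter serve for its own cells.
  have e : g ≫ q.desc = 𝟙 _ := by
    apply (adj.homEquiv _ _).injective
    rw [adj.homEquiv_naturality_right, adj.homEquiv_id]
    exact (congrArg (· ≫ PenMor.forget.map q.desc) (Equiv.apply_symm_apply _ _)).trans q.gen_desc
  obtain ⟨t, ht⟩ := UnderPenMor.exists_eval_source (g.left.app x)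
  refine ⟨t, ?_⟩
  have := ht.map q.desc.isBridge fun y => q.desc_gen y
  have hx : q.desc.left.app (g.left.app x) = x :=
    OmegaGraph.congr_app (congrArg PenMor.forget.map e) x
  rwa [hx] at this

/-! ### Reflection of actions into algebras -/

section

variable {L : OmegaGraph.{u} ⥤ PenMor.{u}} {adj : L ⊣ PenMor.forget.{u}}

/-- Formal terms over an omega graph in the operations of algebras. The terms of sort `false`
denote cells of an algebra `A`, those of sort `true` denote cells of `T A`. -/
inductive AlgTerm (G : OmegaGraph.{u}) : Bool → ℕ → Type u
  | gen {n : ℕ} (y : G.cell n) : AlgTerm G false n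
  | act {n : ℕ} (t : AlgTerm G true n) : AlgTerm G false n
  | unit {n : ℕ} (t : AlgTerm G false n) : AlgTerm G true n
  | dom {b : Bool} {n : ℕ} (t : AlgTerm G b (n + 1)) : AlgTerm G b n
  | cod {b : Bool} {n : ℕ} (t : AlgTerm G b (n + 1)) : AlgTerm G b n
  | ident {b : Bool} {n : ℕ} (t : AlgTerm G b n) : AlgTerm G b (n + 1)
  -- Sort `true` suffices for composites: in an algebra they are obtained by composing units and
  -- then applying the action.
  | comp {i j : ℕ} (h : i < j) (s t : AlgTerm G true j) : AlgTerm G true j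
  | bridge {n : ℕ} (s t : AlgTerm G true n) : AlgTerm G true (n + 1)

/-- The omega graph in which terms of a given sort are evaluated. -/
def Prolixe.sort (A : Prolixe adj) : Bool → OmegaGraph.{u}
  | false => A.A
  | true => (L.obj A.A).source.toOmegaGraph

/-- The action of a morphism of algebras on the omega graphs of all sorts. -/
def Prolixe.sortMap {A B : Prolixe adj} (h : A ⟶ B) : ∀ b : Bool, A.sort b ⟶ B.sort b
  | false => h.f
  | true => PenMor.forget.map (L.map h.f)

namespace AlgTerm

variable {G : OmegaGraph.{u}}

/-- `Eval A f t x` means that the term `t` is defined, with value `x`, in the algebra `A` if the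
generators are interpreted by `f`. -/
def Eval (A : Prolixe adj) (f : G ⟶ A.A) :
    ∀ {b : Bool} {n : ℕ}, AlgTerm G b n → (A.sort b).cell n → Prop
  | _, _, gen y, x => x = f.app y
  | _, _, act t, x => ∃ a, Eval A f t a ∧ x = A.act.app a
  | _, _, unit t, x => ∃ a, Eval A f t a ∧ x = OmegaGraph.Hom.app (adj.unit.app A.A) a
  | _, _, dom t, x => ∃ a, Eval A f t a ∧ x = (A.sort _).dom a
  | _, _, cod t, x => ∃ a, Eval A f t a ∧ x = (A.sort _).cod a
  | _, _, ident t, x => ∃ a, Eval A f t a ∧ x = (A.sort _).ident a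
  | _, _, comp h s t, x => ∃ a b, Eval A f s a ∧ Eval A f t b ∧ (L.obj A.A).source.Comp h a b x
  | _, _, bridge s t, x => ∃ a b, Eval A f s a ∧ Eval A f t b ∧ (L.obj A.A).bridge.Rel a b x

theorem Eval.unique {A : Prolixe adj} {f : G ⟶ A.A} {b : Bool} {n : ℕ} {t : AlgTerm G b n}
    {x y : (A.sort b).cell n} (hx : Eval A f t x) (hy : Eval A f t y) : x = y := by
  induction t with
  | gen z => exact Eq.trans (b := f.app z) hx (Eq.symm hy)
  | act t ih | unit t ih | dom t ih | cod t ih | ident t ih =>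
    obtain ⟨a, ha, rfl⟩ := hx
    obtain ⟨b, hb, rfl⟩ := hy
    rw [ih ha hb]
  | comp h s t ihs iht =>
    obtain ⟨a, b, ha, hb, hx⟩ := hx
    obtain ⟨a', b', ha', hb', hy⟩ := hy
    obtain rfl := ihs ha ha'
    obtain rfl := iht hb hb'
    exact (L.obj A.A).source.comp_unique h hx hy
  | bridge s t ihs iht =>
    obtain ⟨a, b, ha, hb, hx⟩ := hx
    obtain ⟨a', b', ha', hb', hy⟩ := hy
    obtain rfl := ihs ha ha'
    obtain rfl := iht hb hb'
    exact (L.obj A.A).bridge.unique hx hy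

theorem Eval.map {A B : Prolixe adj} {f : G ⟶ A.A} {f' : G ⟶ B.A} (h : A ⟶ B)
    (hf : f ≫ h.f = f') {b : Bool} {n : ℕ} {t : AlgTerm G b n} {x : (A.sort b).cell n}
    (hx : Eval A f t x) : Eval B f' t ((Prolixe.sortMap h b).app x) := by
  induction t with
  | gen z => obtain rfl := hx; subst hf; rfl
  | act t ih =>
    obtain ⟨a, ha, rfl⟩ := hx
    exact ⟨_, ih ha, (OmegaGraph.congr_app h.h a).symm⟩
  | unit t ih =>
    obtain ⟨a, ha, rfl⟩ := hx
    exact ⟨_, ih ha, (OmegaGraph.congr_app (adj.unit.naturality h.f) a).symm⟩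
  | dom t ih => obtain ⟨a, ha, rfl⟩ := hx; exact ⟨_, ih ha, (Prolixe.sortMap h _).map_dom a⟩
  | cod t ih => obtain ⟨a, ha, rfl⟩ := hx; exact ⟨_, ih ha, (Prolixe.sortMap h _).map_cod a⟩
  | ident t ih => obtain ⟨a, ha, rfl⟩ := hx; exact ⟨_, ih ha, (Prolixe.sortMap h _).map_ident a⟩
  | comp hij s t ihs iht =>
    obtain ⟨a, b, ha, hb, hx⟩ := hx
    exact ⟨_, _, ihs ha, iht hb, (L.map h.f).left.map_comp hij hx⟩
  | bridge s t ihs iht =>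
    obtain ⟨a, b, ha, hb, hx⟩ := hx
    exact ⟨_, _, ihs ha, iht hb, (L.map h.f).isBridge hx⟩

end AlgTerm

/-! ### The universal algebra under an action -/

/-- An algebra under an omega graph with an action of the monad. -/
structure UnderAlgebra {G : OmegaGraph.{u}} (act : adj.toMonad.obj G ⟶ G) where
  alg : Prolixe adj
  gen : G ⟶ alg.A
  comm : adj.toMonad.map gen ≫ alg.a = act ≫ gen

namespace UnderAlgebra

variable {G : OmegaGraph.{u}} (act : adj.toMonad.obj G ⟶ G)

/-- The families of cells, in all algebras under `G`, that are the values of a single term. -/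
def termSubgraph : SmallSubgraph fun q : UnderAlgebra act => q.alg.A where
  Mem {n} s := ∃ t : AlgTerm G false n, ∀ q : UnderAlgebra act, AlgTerm.Eval q.alg q.gen t (s q)
  small n := by
    refine small_of_injective (β := AlgTerm G false n) (f := fun s => s.2.choose) fun s s' h => ?_
    have h₁ := s.2.choose_spec
    have h₂ := s'.2.choose_spec
    replace h : s.2.choose = s'.2.choose := h
    rw [← h] at h₂
    exact Subtype.ext (funext fun i => (h₁ i).unique (h₂ i))
  mem_dom := fun ⟨t, ht⟩ => ⟨t.dom, fun i => ⟨_, ht i, rfl⟩⟩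
  mem_cod := fun ⟨t, ht⟩ => ⟨t.cod, fun i => ⟨_, ht i, rfl⟩⟩
  mem_ident := fun ⟨t, ht⟩ => ⟨t.ident, fun i => ⟨_, ht i, rfl⟩⟩

/-- The omega graph underlying the reflection. -/
noncomputable abbrev reflGraph : OmegaGraph.{u} := (termSubgraph act).toGraph

/-- This is substitution: each generator of `t` is a family of cells and is replaced by a term for
that family. The resulting term serves every `q` at once, and nothing is claimed where `t` is
undefined. -/
theorem exists_algTerm {n : ℕ} (t : Term (reflGraph act) n) :
    ∃ t' : AlgTerm G true n, ∀ x : (L.obj (reflGraph act)).source.cell n,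
      t.Eval (L.obj (reflGraph act)).bridge (adj.unit.app (reflGraph act)) x →
      ∀ q : UnderAlgebra act,
        t'.Eval q.alg q.gen ((L.map ((termSubgraph act).proj q)).left.app x) := by
  induction t with
  | gen y =>
    obtain ⟨t, ht⟩ := (termSubgraph act).mem y
    refine ⟨t.unit, ?_⟩
    rintro x rfl q
    exact ⟨_, ht q, (OmegaGraph.congr_app (adj.unit.naturality ((termSubgraph act).proj q)) y).symm⟩
  | dom t ih =>
    obtain ⟨t, ht⟩ := ih
    refine ⟨t.dom, ?_⟩
    rintro x ⟨a, ha, rfl⟩ q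
    exact ⟨_, ht a ha q, OmegaGraph.Hom.map_dom _ _⟩
  | cod t ih =>
    obtain ⟨t, ht⟩ := ih
    refine ⟨t.cod, ?_⟩
    rintro x ⟨a, ha, rfl⟩ q
    exact ⟨_, ht a ha q, OmegaGraph.Hom.map_cod _ _⟩
  | ident t ih =>
    obtain ⟨t, ht⟩ := ih
    refine ⟨t.ident, ?_⟩
    rintro x ⟨a, ha, rfl⟩ q
    exact ⟨_, ht a ha q, OmegaGraph.Hom.map_ident _ _⟩
  | comp h s t ihs iht =>
    obtain ⟨s, hs⟩ := ihs
    obtain ⟨t, ht⟩ := iht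
    refine ⟨s.comp h t, ?_⟩
    rintro x ⟨a, b, ha, hb, hx⟩ q
    exact ⟨_, _, hs a ha q, ht b hb q, OmegaMagma.Hom.map_comp _ h hx⟩
  | bridge s t ihs iht =>
    obtain ⟨s, hs⟩ := ihs
    obtain ⟨t, ht⟩ := iht
    refine ⟨s.bridge t, ?_⟩
    rintro x ⟨a, b, ha, hb, hx⟩ q
    exact ⟨_, _, hs a ha q, ht b hb q, PenMor.Hom.isBridge _ hx⟩

/-- The action of the monad on the reflection. -/
noncomputable def reflAct : adj.toMonad.obj (reflGraph act) ⟶ reflGraph act :=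
  SmallSubgraph.lift (fun q => adj.toMonad.map ((termSubgraph act).proj q) ≫ q.alg.a)
    fun n x => by
      -- The components of `x` in all the `T q.alg.A` are values of one term `t'`, so applying the
      -- actions gives the values of `t'.act`.
      obtain ⟨t, ht⟩ := exists_eval_unit adj (reflGraph act) x
      obtain ⟨t', ht'⟩ := exists_algTerm act t
      exact ⟨t'.act, fun q => ⟨_, ht' x ht q, rfl⟩⟩

theorem reflAct_proj (q : UnderAlgebra act) :
    reflAct act ≫ (termSubgraph act).proj q =
      adj.toMonad.map ((termSubgraph act).proj q) ≫ q.alg.a :=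
  SmallSubgraph.lift_proj _ _ _

/-- The reflection, as an algebra. -/
noncomputable def reflAlg : Prolixe adj where
  A := reflGraph act
  a := reflAct act
  -- The projections are jointly monic and commute with the actions, so both algebra laws are
  -- inherited from the factors.
  unit := SmallSubgraph.hom_ext fun q => by
    rw [Category.assoc, reflAct_proj, ← adj.toMonad.η.naturality_assoc, q.alg.unit]
    exact (Category.comp_id _).trans (Category.id_comp _).symm
  assoc := SmallSubgraph.hom_ext fun q => by
    rw [Category.assoc, Category.assoc, reflAct_proj, ← adj.toMonad.μ.naturality_assoc,
      q.alg.assoc, ← Functor.map_comp_assoc, reflAct_proj, Functor.map_comp, Category.assoc]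
    rfl

/-- The morphism to the reflection. -/
noncomputable def reflGen : G ⟶ reflGraph act :=
  SmallSubgraph.lift (fun q => q.gen) fun _ y => ⟨AlgTerm.gen y, fun _ => rfl⟩

theorem reflGen_proj (q : UnderAlgebra act) : reflGen act ≫ (termSubgraph act).proj q = q.gen :=
  SmallSubgraph.lift_proj _ _ _

/-- The reflection, as an algebra under `G`. -/
noncomputable def refl : UnderAlgebra act where
  alg := reflAlg act
  gen := reflGen act
  comm := SmallSubgraph.hom_ext fun q => by
    change ((adj.toMonad.map (Y := reflGraph act) (reflGen act)) ≫ reflAct act) ≫ _ =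
      (act ≫ reflGen act) ≫ _
    rw [Category.assoc, Category.assoc, reflAct_proj, reflGen_proj, ← Functor.map_comp_assoc,
      reflGen_proj, q.comm]

variable {act}

/-- The morphism of algebras from the reflection to a given algebra under `G`. -/
noncomputable def reflDesc (q : UnderAlgebra act) : reflAlg act ⟶ q.alg :=
  Monad.Algebra.Hom.mk (A := reflAlg act) (B := q.alg) ((termSubgraph act).proj q)
    (reflAct_proj act q).symm

theorem reflAlg_hom_ext {B : Prolixe adj} {f g : reflAlg act ⟶ B}
    (h : reflGen act ≫ f.f = reflGen act ≫ g.f) : f = g := by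
  refine Monad.Algebra.Hom.ext (OmegaGraph.hom_ext fun x => ?_)
  obtain ⟨t, ht⟩ := (termSubgraph act).mem x
  -- As for free categorical Penon morphisms, the projection to the factor that is the reflection
  -- itself is the identity.
  have hx : x = ((termSubgraph act).proj (refl act)).app x := SmallSubgraph.ext fun q =>
    (ht q).unique ((ht (refl act)).map q.reflDesc (reflGen_proj act q))
  have ht' : AlgTerm.Eval (reflAlg act) (reflGen act) t x := by
    rw [hx]
    exact ht (refl act)
  exact (ht'.map f h).unique (ht'.map g rfl)

end UnderAlgebra

/-- A reflection of an action of the monad into the algebras. -/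
structure AlgebraReflection {G : OmegaGraph.{u}} (act : adj.toMonad.obj G ⟶ G) extends
    UnderAlgebra act where
  desc : ∀ q : UnderAlgebra act, alg ⟶ q.alg
  gen_desc : ∀ q : UnderAlgebra act, gen ≫ (desc q).f = q.gen
  hom_ext : ∀ {B : Prolixe adj} {f g : alg ⟶ B}, gen ≫ f.f = gen ≫ g.f → f = g

namespace AlgebraReflection

/-- Every action of the monad has a reflection. -/
noncomputable def ofAction {G : OmegaGraph.{u}} (act : adj.toMonad.obj G ⟶ G) :
    AlgebraReflection act where
  toUnderAlgebra := UnderAlgebra.refl act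
  desc q := q.reflDesc
  gen_desc q := UnderAlgebra.reflGen_proj act q
  hom_ext := UnderAlgebra.reflAlg_hom_ext

/-- An algebra is its own reflection. -/
def ofAlgebra (A : Prolixe adj) : AlgebraReflection A.a where
  alg := A
  gen := 𝟙 A.A
  comm := by rw [CategoryTheory.Functor.map_id, Category.id_comp, Category.comp_id]
  desc q := Monad.Algebra.Hom.mk (A := A) (B := q.alg) q.gen q.comm
  gen_desc q := Category.id_comp _
  hom_ext h := Monad.Algebra.Hom.ext (by rwa [Category.id_comp, Category.id_comp] at h)

end AlgebraReflection

/-! ### The functor to algebras -/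

namespace PenOmegaCat

/-- The reflection of an object of `Pen_Omega_Cat`: the object itself if it is an algebra. -/
noncomputable def reflection (X : PenOmegaCat adj) : AlgebraReflection X.action :=
  open Classical in
  -- The universal property alone would give an algebra only isomorphic to `λ`; the case distinction
  -- gives `λ` itself.
  if h : IsAssociative adj X then
    AlgebraReflection.ofAlgebra (associativeToProlixe.obj ⟨X, h⟩)
  else AlgebraReflection.ofAction X.action

theorem reflection_of_isAssociative (X : (IsAssociative adj).FullSubcategory) :
    X.obj.reflection = AlgebraReflection.ofAlgebra (associativeToProlixe.obj X) :=
  dif_pos X.property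

/-- An omega functor followed by a morphism to an algebra. -/
def underAlgebra {X Y : PenOmegaCat adj} (F : X ⟶ Y) (q : UnderAlgebra Y.action) :
    UnderAlgebra X.action where
  alg := q.alg
  gen := OmegaMagma.forget.map F.hom.F₁ ≫ q.gen
  comm := by
    have h := PenOmegaCat.map_action F
    rw [Functor.map_comp, Category.assoc, q.comm, ← Category.assoc, h, Category.assoc]

variable (adj)

/-- The reflection of `Pen_Omega_Cat` into the algebras. -/
noncomputable def toProlixe : PenOmegaCat adj ⥤ Prolixe adj where
  obj X := X.reflection.alg
  map {X Y} F := X.reflection.desc (underAlgebra F Y.reflection.toUnderAlgebra)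
  map_id X := X.reflection.hom_ext ((X.reflection.gen_desc _).trans
    ((Category.id_comp _).trans (Category.comp_id _).symm))
  map_comp {X Y Z} F G := X.reflection.hom_ext (by
    refine (X.reflection.gen_desc _).trans ?_
    have h₁ := X.reflection.gen_desc (underAlgebra F Y.reflection.toUnderAlgebra)
    have h₂ := Y.reflection.gen_desc (underAlgebra G Z.reflection.toUnderAlgebra)
    change OmegaMagma.forget.map F.hom.F₁ ≫ OmegaMagma.forget.map G.hom.F₁ ≫ _ = _
    refine (congrArg (OmegaMagma.forget.map F.hom.F₁ ≫ ·) h₂.symm).trans ?_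
    refine (Category.assoc _ _ _).symm.trans ?_
    exact (congrArg (· ≫ Monad.Algebra.Hom.f _) h₁.symm).trans (Category.assoc _ _ _))

theorem ι_comp_toProlixe : (IsAssociative adj).ι ⋙ toProlixe adj = associativeToProlixe := by
  refine Functor.hext (fun X => congrArg (fun r => r.alg) (reflection_of_isAssociative X))
    fun X Y F => ?_
  -- The chosen reflections equal the trivial ones only propositionally. With variables in their
  -- place the equations can be substituted, and then `desc` is `F₁` followed by an identity.
  have key : ∀ (r : AlgebraReflection X.obj.action) (s : AlgebraReflection Y.obj.action),
      r = AlgebraReflection.ofAlgebra (associativeToProlixe.obj X) →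
      s = AlgebraReflection.ofAlgebra (associativeToProlixe.obj Y) →
      HEq (r.desc (underAlgebra F.hom s.toUnderAlgebra)) (associativeToProlixe.map F) := by
    rintro r s rfl rfl
    exact heq_of_eq (Monad.Algebra.Hom.ext (Category.comp_id _))
  exact key _ _ (reflection_of_isAssociative X) (reflection_of_isAssociative Y)

end PenOmegaCat

/-! ### The retraction on algebras -/

theorem action_prolixeToPen (A : Prolixe adj) : ((prolixeToPen adj).obj A).action = A.a := by
  change PenMor.forget.map (𝟙 (L.obj A.A)) ≫ A.a = A.a
  rw [PenMor.forget.map_id]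
  exact Category.id_comp _

theorem isAssociative_prolixeToPen (A : Prolixe adj) :
    IsAssociative adj ((prolixeToPen adj).obj A) := by
  have h := action_prolixeToPen A
  change adj.toMonad.μ.app A.A ≫ _ = _
  rw [h]
  exact A.assoc

theorem associativeToProlixe_obj_prolixeToPen (A : Prolixe adj) :
    associativeToProlixe.obj ⟨(prolixeToPen adj).obj A, isAssociative_prolixeToPen A⟩ = A := by
  have key : ∀ (a : adj.toMonad.obj A.A ⟶ A.A) (hu) (ha), a = A.a →
      (⟨A.A, a, hu, ha⟩ : Prolixe adj) = A := by
    rintro a hu ha rfl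
    rfl
  exact key _ _ _ (action_prolixeToPen A)

/-- Reduces comparison of morphisms between propositionally equal algebras to their graph morphisms,
which in the application agree by definition. -/
theorem Prolixe.hom_heq {A B A' B' : Prolixe adj} (hA : A = A') (hB : B = B') {f : A ⟶ B}
    {f' : A' ⟶ B'} (h : HEq f.f f'.f) : HEq f f' := by
  subst hA hB
  exact heq_of_eq (Monad.Algebra.Hom.ext (eq_of_heq h))

variable (adj)

theorem lift_prolixeToPen_comp :
    (IsAssociative adj).lift (prolixeToPen adj) isAssociative_prolixeToPen ⋙
      associativeToProlixe = 𝟭 (Prolixe adj) :=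
  Functor.hext associativeToProlixe_obj_prolixeToPen fun A B _ =>
    Prolixe.hom_heq (associativeToProlixe_obj_prolixeToPen A)
      (associativeToProlixe_obj_prolixeToPen B) HEq.rfl

theorem prolixeToPen_comp_toProlixe :
    prolixeToPen adj ⋙ PenOmegaCat.toProlixe adj = 𝟭 (Prolixe adj) := by
  -- `prolixeToPen` lands in the associative objects, where `U` is `associativeToProlixe`; both
  -- sides become the same composite through that subcategory.
  rw [← lift_prolixeToPen_comp adj, ← PenOmegaCat.ι_comp_toProlixe adj]
  rfl

end

end WeakOmega

/-- `Prolixe` is a retract of `Pen_Omega_Cat`: the free categorical Penon morphism functor exists,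
and, for every choice of it, the functor `S : Prolixe ⥤ Pen_Omega_Cat` has a retraction `U`, which
sends `X` to the algebra `λ : T Y ⟶ Y` (and `F` to `F₁`) wherever `λ` is an algebra. -/
theorem mainTheorem5 :
    (WeakOmega.PenMor.forget.{u}).IsRightAdjoint ∧
      ∀ (L : WeakOmega.OmegaGraph.{u} ⥤ WeakOmega.PenMor.{u})
        (adj : L ⊣ WeakOmega.PenMor.forget.{u}),
        ∃ U : WeakOmega.PenOmegaCat adj ⥤ WeakOmega.Prolixe adj,
          WeakOmega.prolixeToPen adj ⋙ U = 𝟭 (WeakOmega.Prolixe adj) ∧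
          (WeakOmega.IsAssociative adj).ι ⋙ U = WeakOmega.associativeToProlixe :=
  ⟨WeakOmega.PenMor.isRightAdjoint_forget, fun _ adj => ⟨WeakOmega.PenOmegaCat.toProlixe adj,
    WeakOmega.prolixeToPen_comp_toProlixe adj, WeakOmega.PenOmegaCat.ι_comp_toProlixe adj⟩⟩
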